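/- Let $p$ be a prime and let $G$ be a finite abelian $p$-group of order $p^n$. For a free presentation $G\cong F/R$ let $M(G)=(R\cap F')/[R,F]$ be the Schur multiplier of $G$ and let $S_2M(G)=(R\cap F'')/[[R,F],F']$ be its metabelian multiplier (both are independent of the presentation, up to isomorphism). Write $|M(G)|=p^{\frac{n(n-1)}{2}-t}$ with $t\in\mathbb N_0$, let the Frattini subgroup $\Phi(G)$ have order $p^a$, and let $m\in\mathbb N_0$ be such that $2an=a(a+1)+2t+2m$. Suppose that $m=k+s$ with $k,s\in\mathbb N_0$, that $\exp(G)=p^{a-k+1}$, and that $\exp(M(G))\cdot\exp(S_2M(G))=p^{k+r}$ with $r\in\mathbb Z$. Write $\mathbf Z_{q}$ for the cyclic group of order $q$ and $\mathbf Z_p^{(c)}$ for the direct sum of $c$ copies of $\mathbf Z_p$. Then: (i) if $r=2$, then $$G\cong \mathbf Z_{p^{a-k+1}}\oplus\mathbf Z_{p^{k-s+1}}\oplus\mathbf Z_{p^{s+1}}\oplus\mathbf Z_p^{(n-a-3)};$$ (ii) if $r=1$ and $n-a\ge 3$, then $$G\cong \mathbf Z_{p^{a-k+1}}\oplus\mathbf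 Z_{p^{k-s+2}}\oplus\mathbf Z_{p^{s-1}}\oplus\mathbf Z_{p^2}\oplus\mathbf Z_p^{(n-a-4)};$$ (iii) if $r=0$ and $n-a\ge 3$, then $G$ is isomorphic to one of $$\mathbf Z_{p^{a-k+1}}\oplus\mathbf Z_{p^{k-s+4}}\oplus\mathbf Z_{p^{s-4}}\oplus\mathbf Z_{p^2}\oplus\mathbf Z_{p^2}\oplus\mathbf Z_p^{(n-a-5)},$$ $$\mathbf Z_{p^{a-k+1}}\oplus\mathbf Z_{p^{k-s+3}}\oplus\mathbf Z_{p^{s-3}}\oplus\mathbf Z_{p^3}\oplus\mathbf Z_p^{(n-a-4)};$$ (iv) if $r=-1$, then $G$ is isomorphic to one of $$\mathbf Z_{p^{a-k+1}}\oplus\mathbf Z_{p^{k-s+4}}\oplus\mathbf Z_{p^{s-5}}\oplus\mathbf Z_{p^4}\oplus\mathbf Z_p^{(n-a-4)},$$ $$\mathbf Z_{p^{a-k+1}}\oplus\mathbf Z_{p^{k-s+5}}\oplus\mathbf Z_{p^{s-6}}\oplus\mathbf Z_{p^3}\oplus\mathbf Z_{p^2}\oplus\mathbf Z_p^{(n-a-5)},$$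 $$\mathbf Z_{p^{a-k+1}}\oplus\mathbf Z_{p^{k-s+7}}\oplus\mathbf Z_{p^{s-8}}\oplus\mathbf Z_{p^2}\oplus\mathbf Z_{p^2}\oplus\mathbf Z_{p^2}\oplus\mathbf Z_p^{(n-a-6)}.$$ In each decomposition that occurs, the number of copies of $\mathbf Z_p$ is $\ge 0$, and the exponents of $p$ are all $\ge 1$ and are listed in non-increasing order (so that the decomposition is the invariant-factor decomposition of $G$). -/

import Mathlib

namespace AbelianPGroup

/-- For a normal subgroup `R` of a (free) group `F`, the Hopf quotient `(R ∩ F') / [R, F]`. -/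
abbrev HopfQuotient {F : Type*} [Group F] (R : Subgroup F) [R.Normal] : Type _ :=
  ↥(R ⊓ commutator F) ⧸ (⁅R, (⊤ : Subgroup F)⁆).subgroupOf (R ⊓ commutator F)

/-- For a normal subgroup `R` of a (free) group `F`, the quotient
`(R ∩ F'') / [[R, F], F']`, where `F'' = [F', F']`. -/
abbrev MetabelianQuotient {F : Type*} [Group F] (R : Subgroup F) [R.Normal] : Type _ :=
  ↥(R ⊓ ⁅commutator F, commutator F⁆) ⧸
    (⁅⁅R, (⊤ : Subgroup F)⁆, commutator F⁆).subgroupOf (R ⊓ ⁅commutator F, commutator F⁆)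

/-- The relation subgroup of the canonical free presentation of `G`, in which the free group on
the underlying set of `G` maps onto `G` by sending each generator to itself. -/
abbrev relators (G : Type*) [Group G] : Subgroup (FreeGroup G) :=
  (FreeGroup.lift (id : G → G)).ker

/-- The Schur multiplier `M(G) = (R ∩ F') / [R, F]`, where `G = F / R` is the canonical
free presentation (up to isomorphism, every free presentation gives the same group). -/
abbrev SchurMultiplier (G : Type*) [Group G] : Type _ := HopfQuotient (relators G)

/-- The metabelian multiplier `S₂M(G) = (R ∩ F'') / [[R, F], F']`, i.e. the Baer invariant of
`G = F / R` with respect to the variety of solvable groups of length at most two. -/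
abbrev MetabelianMultiplier (G : Type*) [Group G] : Type _ := MetabelianQuotient (relators G)

/-- `G ≅ Z_{p^{e₁}} ⊕ ⋯ ⊕ Z_{p^{e_d}}` with `e₁ ≥ e₂ ≥ ⋯ ≥ e_d ≥ 1`. The exponents are integers,
so that differences such as `s - 4` have their usual meaning; being at least `1` they are not
affected by `Int.toNat`. -/
def HasInvariants (p : ℕ) (G : Type*) [Group G] (e : List ℤ) : Prop :=
  e.Pairwise (fun x y => y ≤ x) ∧ (∀ x ∈ e, 1 ≤ x) ∧
    Nonempty (G ≃* Multiplicative (∀ i : Fin e.length, ZMod (p ^ (e.get i).toNat)))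

end AbelianPGroup

namespace AbelianPGroup

open Function
open scoped commutatorElement

/-! ### Finite products of cyclic groups -/

/-! Write `G = ∏ Z_{p^(b_i+1)}` with `b_0 ≥ b_1 ≥ ⋯` and `d` factors. Everything in the statement
becomes arithmetic in the `b_i` once both multipliers are known.

Since `G` is abelian, `F' ≤ R`, so the multipliers are `F'/[R,F]` and `F''/[[R,F],F']`. The first is
the exterior square `Λ²G` (`exists_commutator_hom`): commutators of lifted generators generate it
with the expected orders, and a map from the free group to an explicit central extension of `G`
shows that there are no further relations. The subgroup `F'` is again free and maps onto `Λ²G` with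
kernel `[R,F]`, so the same theorem gives `S₂M(G) ≅ Λ²(Λ²G)`.

Hence `a = Σ b_i`, `n = a + d`, `|M(G)| = p^(Σ i(b_i+1))`, and the relation defining `m` says `m = Σ
i b_i`. The exponents of `G`, `M(G)`, `S₂M(G)` are `p^(b_0+1)`, `p^(b_1+1)`, `p^(b_2+1)` when `d ≥
3`. So `k = Σ_{i≥1} b_i`, and `b_1 + b_2 + 2 = k + r` leaves `Σ_{i≥3} b_i = 2 - r`. The tail is thus
a partition of 0, 1, 2 or 3. Then `s = m - k = Σ_{i≥2} (i-1) b_i` determines `b_2`, and `k`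
determines `b_1`. -/

theorem prod_ofAdd_single_pow {κ : Type*} [Fintype κ] [DecidableEq κ] {k : κ → ℕ}
    (v : ∀ q, ZMod (k q)) :
    ∏ q, (Multiplicative.ofAdd (Pi.single q 1 : ∀ q, ZMod (k q))) ^ (v q).cast (R := ℤ) =
      Multiplicative.ofAdd v := by
  apply Multiplicative.toAdd.injective
  rw [toAdd_prod]
  simp only [toAdd_zpow, toAdd_ofAdd]
  funext r
  rw [Finset.sum_apply, Finset.sum_eq_single r]
  · simp
  · intro b _ hb
    simp [Pi.single_eq_of_ne (Ne.symm hb)]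
  · simp

theorem closure_range_ofAdd_single {κ : Type*} [Fintype κ] [DecidableEq κ] (k : κ → ℕ) :
    Subgroup.closure
      (Set.range fun q => Multiplicative.ofAdd (Pi.single q 1 : ∀ q, ZMod (k q))) = ⊤ := by
  rw [eq_top_iff]
  intro v _
  rw [← ofAdd_toAdd v, ← prod_ofAdd_single_pow]
  exact Subgroup.prod_mem _ fun q _ =>
    Subgroup.zpow_mem _ (Subgroup.subset_closure (Set.mem_range_self q)) _

theorem exists_prod_zpow_eq {Q : Type*} [CommGroup Q] {κ : Type*} [Fintype κ] {g : κ → Q}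
    (hg : Subgroup.closure (Set.range g) = ⊤) (x : Q) : ∃ a : κ → ℤ, x = ∏ q, g q ^ a q := by
  classical
  have hx : x ∈ Subgroup.closure (Set.range g) := hg ▸ Subgroup.mem_top x
  induction hx using Subgroup.closure_induction with
  | mem y hy =>
    obtain ⟨q, rfl⟩ := hy
    refine ⟨Pi.single q 1, ?_⟩
    rw [Finset.prod_eq_single q]
    · simp
    · intro b _ hb
      simp [Pi.single_eq_of_ne hb]
    · simp
  | one => exact ⟨0, by simp⟩
  | mul y z _ _ hy hz =>
    obtain ⟨a, rfl⟩ := hy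
    obtain ⟨b, rfl⟩ := hz
    exact ⟨a + b, by simp [zpow_add, Finset.prod_mul_distrib]⟩
  | inv y _ hy =>
    obtain ⟨a, rfl⟩ := hy
    exact ⟨-a, by simp⟩

/-- A homomorphism carrying a finite generating family, whose members have orders dividing
`k q`, to the standard basis of `∏ ZMod (k q)` is bijective. -/
theorem bijective_of_map_generators {Q : Type*} [CommGroup Q] {κ : Type*} [Fintype κ]
    [DecidableEq κ] {k : κ → ℕ} {g : κ → Q} (hg : Subgroup.closure (Set.range g) = ⊤)
    (hpow : ∀ q, g q ^ k q = 1) (ψ : Q →* Multiplicative (∀ q, ZMod (k q)))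
    (hψ : ∀ q, ψ (g q) = Multiplicative.ofAdd (Pi.single q 1)) : Bijective ψ := by
  constructor
  · rw [injective_iff_map_eq_one]
    intro x hx
    obtain ⟨a, rfl⟩ := exists_prod_zpow_eq hg x
    refine Finset.prod_eq_one fun q _ => ?_
    have h : ((a q : ℤ) : ZMod (k q)) = 0 := by
      have h1 := congrFun (congrArg Multiplicative.toAdd hx) q
      rw [map_prod, toAdd_prod, Finset.sum_apply, Finset.sum_eq_single q] at h1
      · simpa [hψ] using h1
      · intro b _ hb
        simp [hψ, Pi.single_eq_of_ne (Ne.symm hb)]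
      · simp
    obtain ⟨c, hc⟩ := (ZMod.intCast_zmod_eq_zero_iff_dvd _ _).1 h
    rw [hc, zpow_mul, zpow_natCast, hpow, one_zpow]
  · intro v
    refine ⟨∏ q, g q ^ (v.toAdd q).cast (R := ℤ), ?_⟩
    rw [map_prod]
    simp only [map_zpow, hψ]
    exact prod_ofAdd_single_pow v.toAdd

/-! ### Pairs of indices -/

/-- Strictly increasing pairs of elements of a linear order. -/
@[ext]
structure OrderedPair (ι : Type*) [LinearOrder ι] where
  fst : ι
  snd : ι
  lt : fst < snd

namespace OrderedPair

variable {ι : Type*} [LinearOrder ι]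

theorem toLex_injective : Injective fun q : OrderedPair ι => toLex (q.fst, q.snd) := by
  intro q r h
  have h' := Prod.ext_iff.1 (toLex.injective h)
  exact OrderedPair.ext h'.1 h'.2

/-- An order on pairs allows the construction to be iterated: pairs of pairs index `Λ²(Λ²G)`. -/
noncomputable instance : LinearOrder (OrderedPair ι) :=
  LinearOrder.lift' (fun q : OrderedPair ι => toLex (q.fst, q.snd)) toLex_injective

noncomputable instance [Fintype ι] : Fintype (OrderedPair ι) :=
  Fintype.ofInjective (fun q : OrderedPair ι => (q.fst, q.snd)) toLex_injective

/-- The moduli of the exterior square of `∏ ZMod (m i)`. -/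
def modulus (m : ι → ℕ) (q : OrderedPair ι) : ℕ := (m q.fst).gcd (m q.snd)

theorem modulus_dvd_fst (m : ι → ℕ) (q : OrderedPair ι) : modulus m q ∣ m q.fst :=
  Nat.gcd_dvd_left _ _

theorem modulus_dvd_snd (m : ι → ℕ) (q : OrderedPair ι) : modulus m q ∣ m q.snd :=
  Nat.gcd_dvd_right _ _

end OrderedPair

open OrderedPair

/-! ### The extension of an abelian group by its exterior square -/

section Extension

variable {ι : Type*} [LinearOrder ι] (m : ι → ℕ)

/-- A bilinear cocycle on `∏ ZMod (m i)` whose antisymmetrization is the universal alternating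
map. -/
def exteriorCocycle (x y : ∀ i, ZMod (m i)) : ∀ q : OrderedPair ι, ZMod (modulus m q) :=
  fun q => ZMod.castHom (modulus_dvd_fst m q) _ (x q.fst) *
    ZMod.castHom (modulus_dvd_snd m q) _ (y q.snd)

theorem exteriorCocycle_add_left (x x' y : ∀ i, ZMod (m i)) :
    exteriorCocycle m (x + x') y = exteriorCocycle m x y + exteriorCocycle m x' y := by
  funext q
  simp only [exteriorCocycle, Pi.add_apply, map_add, add_mul]

theorem exteriorCocycle_add_right (x y y' : ∀ i, ZMod (m i)) :
    exteriorCocycle m x (y + y') = exteriorCocycle m x y + exteriorCocycle m x y' := by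
  funext q
  simp only [exteriorCocycle, Pi.add_apply, map_add, mul_add]

@[simp]
theorem exteriorCocycle_zero_left (y : ∀ i, ZMod (m i)) : exteriorCocycle m 0 y = 0 := by
  funext q
  simp only [exteriorCocycle, Pi.zero_apply, map_zero, zero_mul]

@[simp]
theorem exteriorCocycle_zero_right (x : ∀ i, ZMod (m i)) : exteriorCocycle m x 0 = 0 := by
  funext q
  simp only [exteriorCocycle, Pi.zero_apply, map_zero, mul_zero]

@[simp]
theorem exteriorCocycle_neg_left (x y : ∀ i, ZMod (m i)) :
    exteriorCocycle m (-x) y = -exteriorCocycle m x y := by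
  funext q
  simp only [exteriorCocycle, Pi.neg_apply, map_neg, neg_mul]

theorem exteriorCocycle_single (q : OrderedPair ι) :
    exteriorCocycle m (Pi.single q.fst 1) (Pi.single q.snd 1) -
      exteriorCocycle m (Pi.single q.snd 1) (Pi.single q.fst 1) = Pi.single q 1 := by
  funext r
  rw [Pi.sub_apply]
  -- A nonzero coordinate would need `r` to be `q` reversed, but both pairs are increasing.
  have h2 : exteriorCocycle m (Pi.single q.snd 1) (Pi.single q.fst 1) r = 0 := by
    unfold exteriorCocycle
    by_cases h : r.fst = q.snd
    · have h' : r.snd ≠ q.fst := fun h' => lt_asymm r.lt (h' ▸ h ▸ q.lt)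
      rw [Pi.single_eq_of_ne h', map_zero, mul_zero]
    · rw [Pi.single_eq_of_ne h, map_zero, zero_mul]
  rw [h2, sub_zero]
  by_cases h : r = q
  · subst h
    rw [exteriorCocycle, Pi.single_eq_same, Pi.single_eq_same, Pi.single_eq_same, map_one, map_one,
      mul_one]
  · rw [Pi.single_eq_of_ne h]
    unfold exteriorCocycle
    by_cases h1 : r.fst = q.fst
    · have h' : r.snd ≠ q.snd := fun h' => h (OrderedPair.ext h1 h')
      rw [Pi.single_eq_of_ne h', map_zero, mul_zero]
    · rw [Pi.single_eq_of_ne h1, map_zero, zero_mul]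

/-- The central extension of `∏ ZMod (m i)` by its exterior square with universal commutator
pairing. -/
@[ext]
structure ExteriorExtension where
  base : ∀ i, ZMod (m i)
  centre : ∀ q : OrderedPair ι, ZMod (modulus m q)

namespace ExteriorExtension

variable {m}

instance : Mul (ExteriorExtension m) :=
  ⟨fun a b => ⟨a.base + b.base, a.centre + b.centre + exteriorCocycle m a.base b.base⟩⟩

instance : One (ExteriorExtension m) := ⟨⟨0, 0⟩⟩

instance : Inv (ExteriorExtension m) :=
  ⟨fun a => ⟨-a.base, -a.centre + exteriorCocycle m a.base a.base⟩⟩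

@[simp]
theorem base_mul (a b : ExteriorExtension m) : (a * b).base = a.base + b.base := rfl

@[simp]
theorem centre_mul (a b : ExteriorExtension m) :
    (a * b).centre = a.centre + b.centre + exteriorCocycle m a.base b.base := rfl

@[simp]
theorem base_one : (1 : ExteriorExtension m).base = 0 := rfl

@[simp]
theorem centre_one : (1 : ExteriorExtension m).centre = 0 := rfl

@[simp]
theorem base_inv (a : ExteriorExtension m) : a⁻¹.base = -a.base := rfl

@[simp]
theorem centre_inv (a : ExteriorExtension m) :
    a⁻¹.centre = -a.centre + exteriorCocycle m a.base a.base := rfl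

/-- Associativity is the cocycle identity, which follows from biadditivity. -/
instance : Group (ExteriorExtension m) :=
  Group.ofLeftAxioms
    (fun a b c => by
      ext1
      · simp [add_assoc]
      · simp only [centre_mul, base_mul, exteriorCocycle_add_left, exteriorCocycle_add_right]
        abel)
    (fun a => by ext1 <;> simp)
    (fun a => by ext1 <;> simp)

/-- The projection of the extension onto the abelian group. -/
def baseHom : ExteriorExtension m →* Multiplicative (∀ i, ZMod (m i)) where
  toFun a := Multiplicative.ofAdd a.base
  map_one' := rfl
  map_mul' _ _ := rfl

theorem commutatorElement_eq (a b : ExteriorExtension m) :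
    ⁅a, b⁆ = ⟨0, exteriorCocycle m a.base b.base - exteriorCocycle m b.base a.base⟩ := by
  rw [commutatorElement_def, mul_inv_eq_iff_eq_mul, mul_inv_eq_iff_eq_mul]
  ext1
  · simp [add_comm]
  · simp only [centre_mul, base_mul, exteriorCocycle_zero_left, zero_add]
    abel

end ExteriorExtension

end Extension

/-! ### Commutators modulo `[R, F]` -/

section Commutators

variable {F : Type*} [Group F]

/-- Conjugation fixes a central commutator, so `[a^(n+1), b] = [a, b][a^n, b]`. -/
theorem commutatorElement_pow_left {a b : F} (h : ∀ y, Commute ⁅a, b⁆ y) (n : ℕ) :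
    ⁅a ^ n, b⁆ = ⁅a, b⁆ ^ n := by
  induction n with
  | zero => simp
  | succ n ih =>
    have h1 : ⁅a ^ (n + 1), b⁆ = a ^ n * ⁅a, b⁆ * (a ^ n)⁻¹ * ⁅a ^ n, b⁆ := by
      simp only [commutatorElement_def, pow_succ]
      group
    rw [h1, ← (h (a ^ n)).eq, mul_inv_cancel_right, ih, pow_succ']

/-- Conjugating `l ∈ L ≤ R` by `g` changes it only by `[l, g]⁻¹`, which lies in `[R, F] ≤ L`. -/
theorem normal_of_commutator_le {R L : Subgroup F} (h1 : ⁅R, (⊤ : Subgroup F)⁆ ≤ L)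
    (h2 : L ≤ R) : L.Normal := by
  constructor
  intro l hl g
  have h3 : ⁅l, g⁆ ∈ L := h1 (Subgroup.commutator_mem_commutator (h2 hl) (Subgroup.mem_top g))
  have h4 : g * l * g⁻¹ = ⁅l, g⁆⁻¹ * l := by
    simp only [commutatorElement_def]
    group
  rw [h4]
  exact L.mul_mem (L.inv_mem h3) hl

/-- Modulo `L` the generators commute pairwise, so the quotient is abelian. -/
theorem commutator_le_of_closure_eq_top {L : Subgroup F} [L.Normal] {T : Set F}
    (hT : Subgroup.closure T = ⊤) (h : ∀ x ∈ T, ∀ y ∈ T, ⁅x, y⁆ ∈ L) : commutator F ≤ L := by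
  have comm_iff (x y : F) : ⁅x, y⁆ ∈ L ↔ Commute (x : F ⧸ L) (y : F ⧸ L) := by
    rw [← QuotientGroup.eq_one_iff, ← QuotientGroup.mk'_apply, map_commutatorElement,
      commutatorElement_eq_one_iff_commute]
    rfl
  have h1 : ∀ x ∈ T, ∀ y : F, ⁅x, y⁆ ∈ L := by
    intro x hx y
    have hy : y ∈ Subgroup.closure T := hT ▸ Subgroup.mem_top y
    induction hy using Subgroup.closure_induction with
    | mem y hy => exact h x hx y hy
    | one => simp
    | mul y z _ _ hy hz =>
      rw [comm_iff] at *
      exact hy.mul_right hz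
    | inv y _ hy =>
      rw [comm_iff] at *
      exact hy.inv_right
  rw [commutator_def, Subgroup.commutator_le]
  intro x hx y _
  rw [← hT] at hx
  induction hx using Subgroup.closure_induction with
  | mem x hx => exact h1 x hx y
  | one => simp
  | mul y z _ _ hy hz =>
    rw [comm_iff] at *
    exact hy.mul_left hz
  | inv y _ hy =>
    rw [comm_iff] at *
    exact hy.inv_left

end Commutators

/-! ### The derived subgroup of a free group modulo `[R, F]` -/

/-- If `F` is free and `F / R ≅ ∏ ZMod (m i)`, then `F' / [R, F]` is the exterior square
`∏_{i < j} ZMod (gcd (m i) (m j))`. -/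
theorem exists_commutator_hom {F : Type*} [Group F] [IsFreeGroup F] {ι : Type*} [LinearOrder ι]
    [Fintype ι] (m : ι → ℕ) (φ : F →* Multiplicative (∀ i, ZMod (m i))) (hφ : Surjective φ) :
    ∃ ψ : ↥(commutator F) →* Multiplicative (∀ q : OrderedPair ι, ZMod (modulus m q)),
      Surjective ψ ∧ ψ.ker = (⁅φ.ker, (⊤ : Subgroup F)⁆).subgroupOf (commutator F) := by
  -- Freeness lifts `φ` to the central extension; the central parts of the generators are arbitrary,
  -- here 0.
  obtain ⟨Φ, hΦ⟩ : ∃ Φ : F →* ExteriorExtension m, ExteriorExtension.baseHom.comp Φ = φ :=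
    ⟨IsFreeGroup.lift fun x => ⟨(φ (IsFreeGroup.of x)).toAdd, 0⟩,
      IsFreeGroup.ext_hom fun x => by simp [ExteriorExtension.baseHom]⟩
  have base_eq (x : F) : (Φ x).base = (φ x).toAdd := by
    rw [← hΦ]
    rfl
  have base_zero {x : F} (hx : x ∈ φ.ker) : (Φ x).base = 0 := by
    rw [base_eq, hx, toAdd_one]
  have hF' : commutator F ≤ φ.ker := Abelianization.commutator_subset_ker φ
  -- On `F' ≤ R` the base component vanishes, hence so does the cocycle, and the central component
  -- is additive.
  let ψ : ↥(commutator F) →* Multiplicative (∀ q : OrderedPair ι, ZMod (modulus m q)) :=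
    { toFun := fun x => Multiplicative.ofAdd (Φ x).centre
      map_one' := by simp
      map_mul' := fun x y => by
        rw [← ofAdd_add, Subgroup.coe_mul, map_mul, ExteriorExtension.centre_mul,
          base_zero (hF' x.2), exteriorCocycle_zero_left, add_zero] }
  let N : Subgroup ↥(commutator F) := (⁅φ.ker, (⊤ : Subgroup F)⁆).subgroupOf (commutator F)
  have hN : N ≤ ψ.ker := by
    have h1 : ⁅φ.ker, (⊤ : Subgroup F)⁆ ≤ Φ.ker := by
      rw [Subgroup.commutator_le]
      intro x hx y _
      rw [MonoidHom.mem_ker, map_commutatorElement, ExteriorExtension.commutatorElement_eq,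
        base_zero hx]
      simp
      rfl
    intro x hx
    rw [MonoidHom.mem_ker]
    have h2 : Φ x = 1 := h1 hx
    simp [ψ, h2]
  -- Lifts of the standard generators and their commutators
  choose f hf using fun i => hφ (Multiplicative.ofAdd (Pi.single i 1))
  let c : OrderedPair ι → ↥(commutator F) := fun q =>
    ⟨⁅f q.fst, f q.snd⁆,
      Subgroup.commutator_mem_commutator (Subgroup.mem_top _) (Subgroup.mem_top _)⟩
  have hψc (q : OrderedPair ι) : ψ (c q) = Multiplicative.ofAdd (Pi.single q 1) := by
    change Multiplicative.ofAdd (Φ ⁅f q.fst, f q.snd⁆).centre = _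
    rw [map_commutatorElement, ExteriorExtension.commutatorElement_eq, base_eq, base_eq, hf, hf]
    exact congrArg _ (exteriorCocycle_single m q)
  have hT : Subgroup.closure (Set.range f ∪ φ.ker) = ⊤ := by
    rw [Subgroup.closure_union, Subgroup.closure_eq, eq_top_iff]
    intro x _
    have h1 : φ x ∈ (Subgroup.closure (Set.range f)).map φ := by
      rw [MonoidHom.map_closure, ← Set.range_comp]
      have : φ ∘ f = fun i => Multiplicative.ofAdd (Pi.single i 1) := funext hf
      rw [this, closure_range_ofAdd_single]
      trivial
    obtain ⟨y, hy, hyx⟩ := h1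
    have h2 : y⁻¹ * x ∈ φ.ker := by
      rw [MonoidHom.mem_ker, map_mul, map_inv, hyx, inv_mul_cancel]
    rw [← mul_inv_cancel_left y x]
    exact Subgroup.mul_mem_sup hy h2
  -- `F` is generated by the lifts `f i` and `R`. A commutator of two lifts is trivial or some `c q`
  -- up to inversion, and one involving `R` lies in `[R, F]`; so `L` contains `F'`.
  let L : Subgroup F := ⁅φ.ker, (⊤ : Subgroup F)⁆ ⊔ Subgroup.closure (Set.range fun q => (c q : F))
  have hL1 : ⁅φ.ker, (⊤ : Subgroup F)⁆ ≤ L := le_sup_left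
  have hcL (q : OrderedPair ι) : ⁅f q.fst, f q.snd⁆ ∈ L :=
    Subgroup.mem_sup_right (Subgroup.subset_closure ⟨q, rfl⟩)
  have : L.Normal := normal_of_commutator_le hL1
    (sup_le (Subgroup.commutator_le_left _ _) ((Subgroup.closure_le _).2 (by
      rintro _ ⟨q, rfl⟩
      exact hF' (c q).2)))
  have hL : commutator F ≤ L := by
    refine commutator_le_of_closure_eq_top hT ?_
    rintro x (⟨i, rfl⟩ | hx) y (⟨j, rfl⟩ | hy)
    · rcases lt_trichotomy i j with h | h | h
      · exact hcL ⟨i, j, h⟩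
      · rw [h, commutatorElement_self]
        exact L.one_mem
      · rw [← commutatorElement_inv]
        exact L.inv_mem (hcL ⟨j, i, h⟩)
    · rw [← commutatorElement_inv]
      exact L.inv_mem (hL1 (Subgroup.commutator_mem_commutator hy (Subgroup.mem_top _)))
    · exact hL1 (Subgroup.commutator_mem_commutator hx (Subgroup.mem_top _))
    · exact hL1 (Subgroup.commutator_mem_commutator hx (Subgroup.mem_top _))
  -- The quotient by `N` is abelian and generated by the classes of the `c q`
  let _ : CommGroup (↥(commutator F) ⧸ N) :=
    { (inferInstance : Group (↥(commutator F) ⧸ N)) with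
      mul_comm := fun a b => by
        induction a using QuotientGroup.induction_on with | _ a
        induction b using QuotientGroup.induction_on with | _ b
        rw [← QuotientGroup.mk_mul, ← QuotientGroup.mk_mul, QuotientGroup.eq]
        have h1 : (a * b)⁻¹ * (b * a) = ⁅b⁻¹, a⁻¹⁆ := by
          simp only [commutatorElement_def]
          group
        rw [h1]
        exact Subgroup.commutator_mem_commutator (hF' (b⁻¹).2) (Subgroup.mem_top _) }
  let ψ' : ↥(commutator F) ⧸ N →* Multiplicative (∀ q : OrderedPair ι, ZMod (modulus m q)) :=
    QuotientGroup.lift N ψ hN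
  have hgen : Subgroup.closure (Set.range fun q => (c q : ↥(commutator F) ⧸ N)) = ⊤ := by
    rw [eq_top_iff]
    intro x _
    induction x using QuotientGroup.induction_on with | _ x
    obtain ⟨u, hu, v, hv, huv⟩ := Subgroup.mem_sup_of_normal_left.1 (hL x.2)
    have hv' : v ∈ (Subgroup.closure (Set.range c)).map (commutator F).subtype := by
      rw [MonoidHom.map_closure, ← Set.range_comp]
      exact hv
    obtain ⟨w, hw, rfl⟩ := hv'
    have hxw : (x : ↥(commutator F) ⧸ N) = w := by
      rw [eq_comm, QuotientGroup.eq, ← Subgroup.Normal.mem_comm_iff inferInstance]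
      change (x : F) * (w : F)⁻¹ ∈ ⁅φ.ker, (⊤ : Subgroup F)⁆
      rw [← huv]
      simpa using hu
    rw [hxw]
    have h1 : (w : ↥(commutator F) ⧸ N) ∈
        (Subgroup.closure (Set.range c)).map (QuotientGroup.mk' N) := ⟨w, hw, rfl⟩
    rw [MonoidHom.map_closure, ← Set.range_comp] at h1
    exact h1
  -- As `F' ≤ R`, commutators are central modulo `[R, F]`, so `[f i, f j]^(m i)` is congruent to
  -- `[(f i)^(m i), f j]`, which lies in `[R, F]`. By inversion `m j` works as well, hence so does
  -- the gcd.
  have hpow (q : OrderedPair ι) : (c q : ↥(commutator F) ⧸ N) ^ modulus m q = 1 := by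
    have key (i j : ι) : ⁅f i, f j⁆ ^ m i ∈ ⁅φ.ker, (⊤ : Subgroup F)⁆ := by
      have hfi : f i ^ m i ∈ φ.ker := by
        rw [MonoidHom.mem_ker, map_pow, hf, ← ofAdd_nsmul, ← Pi.single_smul]
        simp
      rw [← QuotientGroup.eq_one_iff, ← QuotientGroup.mk'_apply, map_pow, map_commutatorElement,
        ← commutatorElement_pow_left, ← map_pow, ← map_commutatorElement,
        QuotientGroup.mk'_apply, QuotientGroup.eq_one_iff]
      · exact Subgroup.commutator_mem_commutator hfi (Subgroup.mem_top _)
      · intro y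
        induction y using QuotientGroup.induction_on with | _ y
        rw [← commutatorElement_eq_one_iff_commute, ← QuotientGroup.mk'_apply,
          ← map_commutatorElement, ← map_commutatorElement, QuotientGroup.mk'_apply,
          QuotientGroup.eq_one_iff]
        exact Subgroup.commutator_mem_commutator
          (hF' (Subgroup.commutator_mem_commutator (Subgroup.mem_top _) (Subgroup.mem_top _)))
          (Subgroup.mem_top _)
    refine pow_gcd_eq_one.2 ⟨?_, ?_⟩
    · rw [← QuotientGroup.mk_pow, QuotientGroup.eq_one_iff]
      exact key q.fst q.snd
    · rw [← QuotientGroup.mk_pow, QuotientGroup.eq_one_iff]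
      change ⁅f q.fst, f q.snd⁆ ^ m q.snd ∈ ⁅φ.ker, (⊤ : Subgroup F)⁆
      rw [← commutatorElement_inv, inv_pow]
      exact Subgroup.inv_mem _ (key q.snd q.fst)
  have hbij : Bijective ψ' := bijective_of_map_generators hgen hpow ψ' hψc
  refine ⟨ψ, ?_, le_antisymm ?_ hN⟩
  · intro v
    obtain ⟨x, rfl⟩ := hbij.2 v
    induction x using QuotientGroup.induction_on with | _ x
    exact ⟨x, rfl⟩
  · intro x hx
    rw [← QuotientGroup.eq_one_iff]
    apply hbij.1
    rw [map_one]
    exact hx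

/-! ### The two multipliers of a finite abelian group -/

section Multipliers

variable {F : Type*} [Group F] [IsFreeGroup F] {ι : Type*} [LinearOrder ι] [Fintype ι]

theorem nonempty_hopfQuotient_mulEquiv (m : ι → ℕ)
    (φ : F →* Multiplicative (∀ i, ZMod (m i))) (hφ : Surjective φ) (R : Subgroup F) [R.Normal]
    (hR : φ.ker = R) :
    Nonempty (HopfQuotient R ≃* Multiplicative (∀ q : OrderedPair ι, ZMod (modulus m q))) := by
  subst hR
  obtain ⟨ψ, hψ, hker⟩ := exists_commutator_hom m φ hφ
  have hle : commutator F ≤ φ.ker := Abelianization.commutator_subset_ker φ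
  let θ := ψ.comp (Subgroup.inclusion (inf_le_right : φ.ker ⊓ commutator F ≤ commutator F))
  have hθ : Surjective θ := hψ.comp fun x => ⟨⟨x, hle x.2, x.2⟩, rfl⟩
  have hθker : (⁅φ.ker, (⊤ : Subgroup F)⁆).subgroupOf (φ.ker ⊓ commutator F) = θ.ker := by
    rw [← MonoidHom.comap_ker, hker]
    rfl
  exact ⟨(QuotientGroup.quotientMulEquivOfEq hθker).trans
    (QuotientGroup.quotientKerEquivOfSurjective θ hθ)⟩

theorem nonempty_metabelianQuotient_mulEquiv (m : ι → ℕ)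
    (φ : F →* Multiplicative (∀ i, ZMod (m i))) (hφ : Surjective φ) (R : Subgroup F) [R.Normal]
    (hR : φ.ker = R) :
    Nonempty (MetabelianQuotient R ≃*
      Multiplicative (∀ q : OrderedPair (OrderedPair ι), ZMod (modulus (modulus m) q))) := by
  subst hR
  obtain ⟨ψ, hψ, hker⟩ := exists_commutator_hom m φ hφ
  -- By Nielsen–Schreier `F'` is free, so the theorem applies to `ψ` in place of `φ`. The rest
  -- transports subgroups of `F'` to `F`.
  obtain ⟨χ, hχ, hχker⟩ := exists_commutator_hom (modulus m) ψ hψ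
  have hle : ⁅commutator F, commutator F⁆ ≤ φ.ker :=
    (Subgroup.commutator_mono le_top le_top).trans (Abelianization.commutator_subset_ker φ)
  have hmap : (commutator ↥(commutator F)).map (commutator F).subtype =
      ⁅commutator F, commutator F⁆ := Subgroup.map_subtype_commutator _
  have hmap' : (⁅ψ.ker, (⊤ : Subgroup ↥(commutator F))⁆).map (commutator F).subtype =
      ⁅⁅φ.ker, (⊤ : Subgroup F)⁆, commutator F⁆ := by
    rw [Subgroup.map_commutator, hker, Subgroup.subgroupOf_map_subtype, ← MonoidHom.range_eq_map,
      Subgroup.range_subtype, inf_eq_left.2]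
    exact Subgroup.commutator_mono le_top le_rfl
  let ε : ↥(φ.ker ⊓ ⁅commutator F, commutator F⁆) →* ↥(commutator ↥(commutator F)) :=
    { toFun := fun x => ⟨⟨x, Subgroup.commutator_le_left _ _ x.2.2⟩, by
        obtain ⟨y, hy, hyx⟩ := hmap.ge x.2.2
        rwa [← show y = ⟨x, Subgroup.commutator_le_left _ _ x.2.2⟩ from Subtype.ext hyx]⟩
      map_one' := rfl
      map_mul' := fun _ _ => rfl }
  have hε : Surjective ε := fun y =>
    have hy : ((y : ↥(commutator F)) : F) ∈ ⁅commutator F, commutator F⁆ := hmap.le ⟨y, y.2, rfl⟩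
    ⟨⟨y, hle hy, hy⟩, rfl⟩
  let θ := χ.comp ε
  have hθ : Surjective θ := hχ.comp hε
  have hθker : (⁅⁅φ.ker, (⊤ : Subgroup F)⁆, commutator F⁆).subgroupOf
      (φ.ker ⊓ ⁅commutator F, commutator F⁆) = θ.ker := by
    rw [← MonoidHom.comap_ker, hχker]
    ext x
    rw [Subgroup.mem_subgroupOf, Subgroup.mem_comap, Subgroup.mem_subgroupOf, ← hmap']
    constructor
    · rintro ⟨y, hy, hyx⟩
      rwa [← show y = ε x from Subtype.ext hyx]
    · intro h
      exact ⟨_, h, rfl⟩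
  exact ⟨(QuotientGroup.quotientMulEquivOfEq hθker).trans
    (QuotientGroup.quotientKerEquivOfSurjective θ hθ)⟩

end Multipliers

theorem exists_freeGroup_hom {G : Type*} [Group G] {ι : Type*} (m : ι → ℕ)
    (e : G ≃* Multiplicative (∀ i, ZMod (m i))) :
    ∃ φ : FreeGroup G →* Multiplicative (∀ i, ZMod (m i)),
    Surjective φ ∧ φ.ker = relators G := by
  refine ⟨e.toMonoidHom.comp (FreeGroup.lift id), e.surjective.comp fun g => ⟨FreeGroup.of g, ?_⟩,
    ?_⟩
  · simp
  · exact MonoidHom.ker_mulEquiv_comp _ e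

theorem nonempty_schurMultiplier_mulEquiv {G : Type*} [Group G] {ι : Type*} [LinearOrder ι]
    [Fintype ι] (m : ι → ℕ) (e : G ≃* Multiplicative (∀ i, ZMod (m i))) :
    Nonempty (SchurMultiplier G ≃*
      Multiplicative (∀ q : OrderedPair ι, ZMod (modulus m q))) := by
  obtain ⟨φ, hφ, hker⟩ := exists_freeGroup_hom m e
  exact nonempty_hopfQuotient_mulEquiv m φ hφ _ hker

theorem nonempty_metabelianMultiplier_mulEquiv {G : Type*} [Group G] {ι : Type*} [LinearOrder ι]
    [Fintype ι] (m : ι → ℕ) (e : G ≃* Multiplicative (∀ i, ZMod (m i))) :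
    Nonempty (MetabelianMultiplier G ≃*
      Multiplicative (∀ q : OrderedPair (OrderedPair ι), ZMod (modulus (modulus m) q))) := by
  obtain ⟨φ, hφ, hker⟩ := exists_freeGroup_hom m e
  exact nonempty_metabelianQuotient_mulEquiv m φ hφ _ hker

/-! ### Orders and exponents -/

theorem card_multiplicative_pi_zmod {κ : Type*} [Fintype κ] (p : ℕ) (f : κ → ℕ) :
    Nat.card (Multiplicative (∀ i, ZMod (p ^ f i))) = p ^ ∑ i, f i := by
  rw [Nat.card_congr Multiplicative.toAdd, Nat.card_pi]
  simp only [Nat.card_zmod, Finset.prod_pow_eq_pow_sum]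

theorem exponent_multiplicative_pi_zmod {κ : Type*} [Fintype κ] (m : κ → ℕ) :
    Monoid.exponent (Multiplicative (∀ i, ZMod (m i))) = Finset.univ.lcm m := by
  rw [Monoid.exponent_eq_of_mulEquiv (MulEquiv.piMultiplicative _), Monoid.exponent_pi]
  simp only [Monoid.exponent_multiplicative, ZMod.exponent]

theorem exponent_multiplicative_pi_zmod_of_dvd {κ : Type*} [Fintype κ] {m : κ → ℕ} (i : κ)
    (h : ∀ j, m j ∣ m i) : Monoid.exponent (Multiplicative (∀ i, ZMod (m i))) = m i := by
  rw [exponent_multiplicative_pi_zmod]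
  exact Nat.dvd_antisymm (Finset.lcm_dvd fun j _ => h j) (Finset.dvd_lcm (Finset.mem_univ i))

theorem exponent_multiplicative_pi_zmod_of_isEmpty {κ : Type*} [Fintype κ] [IsEmpty κ]
    (m : κ → ℕ) : Monoid.exponent (Multiplicative (∀ i, ZMod (m i))) = 1 := by
  rw [exponent_multiplicative_pi_zmod, Finset.univ_eq_empty, Finset.lcm_empty]

theorem OrderedPair.isEmpty_of_subsingleton (ι : Type*) [LinearOrder ι] [Subsingleton ι] :
    IsEmpty (OrderedPair ι) :=
  ⟨fun q => q.lt.ne (Subsingleton.elim _ _)⟩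

theorem OrderedPair.sum_snd {d : ℕ} (f : Fin d → ℕ) :
    ∑ q : OrderedPair (Fin d), f q.snd = ∑ j : Fin d, (j : ℕ) * f j := by
  -- Each `j` is the larger member of exactly `j` pairs.
  let ε : OrderedPair (Fin d) ≃ (j : Fin d) × Fin j :=
    { toFun := fun q => ⟨q.snd, ⟨q.fst, q.lt⟩⟩
      invFun := fun s => ⟨⟨s.2, s.2.2.trans s.1.2⟩, s.1, s.2.2⟩
      left_inv := fun _ => rfl
      right_inv := fun _ => rfl }
  rw [Fintype.sum_equiv ε (fun q => f q.snd) (fun s => f s.1) fun _ => rfl, Fintype.sum_sigma]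
  simp

theorem modulus_eq_of_dvd {ι : Type*} [LinearOrder ι] {m : ι → ℕ}
    (h : ∀ i j, i ≤ j → m j ∣ m i) (q : OrderedPair ι) : modulus m q = m q.snd :=
  Nat.gcd_eq_right (h _ _ q.lt.le)

/-! ### The Frattini subgroup -/

section Frattini

/-- If `y^p ∉ M`, maximality gives `y = z y^(pj)` with `z ∈ M`, so `y^(1-pj) ∈ M`. Since `1 - pj` is
coprime to the `p`-power that kills `y`, this forces `y ∈ M`, a contradiction. -/
theorem pow_mem_of_isCoatom {G : Type*} [CommGroup G] {p : ℕ} (hG : IsPGroup p G)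
    {M : Subgroup G} (hM : IsCoatom M) (y : G) : y ^ p ∈ M := by
  by_contra hy
  have h1 : M ⊔ Subgroup.zpowers (y ^ p) = ⊤ := by
    refine hM.2 _ (lt_of_le_of_ne le_sup_left fun h => hy ?_)
    rw [h]
    exact Subgroup.mem_sup_right (Subgroup.mem_zpowers _)
  obtain ⟨z, hz, w, ⟨j, rfl⟩, hzw⟩ := Subgroup.mem_sup.1 (h1 ▸ Subgroup.mem_top y)
  have h2 : y ^ (1 - (p : ℤ) * j) ∈ M := by
    have : y ^ (1 - (p : ℤ) * j) = z := by
      rw [zpow_sub, zpow_one, zpow_mul, zpow_natCast, ← eq_mul_inv_of_mul_eq hzw]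
    rwa [this]
  obtain ⟨l, hl⟩ := hG y
  have h3 : IsCoprime (1 - (p : ℤ) * j) ((p ^ l : ℕ) : ℤ) := by
    rw [Nat.cast_pow]
    exact IsCoprime.pow_right ⟨1, j, by ring⟩
  obtain ⟨u, v, huv⟩ := h3
  have h4 : y ∈ M := by
    have : y = (y ^ (1 - (p : ℤ) * j)) ^ u := by
      conv_lhs => rw [← zpow_one y, ← huv, zpow_add, mul_comm v, zpow_mul y _ v, zpow_natCast, hl,
        one_zpow, mul_one, mul_comm u, zpow_mul]
    rw [this]
    exact M.zpow_mem h2 u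
  exact hy (M.pow_mem h4 p)

theorem powMonoidHom_range_le_frattini {G : Type*} [CommGroup G] {p : ℕ}
    (hG : IsPGroup p G) : (powMonoidHom p : G →* G).range ≤ frattini G := by
  rintro _ ⟨y, rfl⟩
  simp only [frattini, Order.radical, Subgroup.mem_iInf]
  exact fun M hM => pow_mem_of_isCoatom hG hM y

theorem frattini_eq_bot_of_card_prime {G : Type*} [CommGroup G] {p : ℕ} (hp : p.Prime)
    (hG : Nat.card G = p) : frattini G = ⊥ := by
  have : IsSimpleGroup G := CommGroup.is_simple_iff_prime_card.2 (hG ▸ hp)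
  exact le_bot_iff.1 (frattini_le_coatom isCoatom_bot)

theorem frattini_multiplicative_pi_zmod {κ : Type*} [Fintype κ] [DecidableEq κ] {p : ℕ}
    (hp : p.Prime) (f : κ → ℕ) :
    frattini (Multiplicative (∀ i, ZMod (p ^ (f i + 1)))) = (powMonoidHom p).range := by
  refine le_antisymm ?_ (powMonoidHom_range_le_frattini
    (IsPGroup.of_card (card_multiplicative_pi_zmod p fun i => f i + 1)))
  intro x hx
  have hdvd (i) : p ∣ p ^ (f i + 1) := dvd_pow_self p (Nat.succ_ne_zero _)
  -- Reducing coordinate `i` modulo `p` maps onto a group of order `p`, whose Frattini subgroup is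
  -- trivial; so each coordinate of `x` is divisible by `p`.
  have h1 (i) : ((x.toAdd i).val : ZMod p) = 0 := by
    let χ : Multiplicative (∀ i, ZMod (p ^ (f i + 1))) →* Multiplicative (ZMod p) :=
      AddMonoidHom.toMultiplicative
        ((ZMod.castHom (hdvd i) (ZMod p)).toAddMonoidHom.comp (Pi.evalAddMonoidHom _ i))
    have hχ : Surjective χ := by
      intro v
      obtain ⟨u, hu⟩ := ZMod.castHom_surjective (hdvd i) v.toAdd
      refine ⟨Multiplicative.ofAdd (Pi.single i u), ?_⟩
      change Multiplicative.ofAdd (ZMod.castHom (hdvd i) (ZMod p)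
        ((Pi.single i u : ∀ i, ZMod (p ^ (f i + 1))) i)) = v
      rw [Pi.single_eq_same, hu, ofAdd_toAdd]
    have h2 := frattini_le_comap_frattini_of_surjective hχ hx
    rw [frattini_eq_bot_of_card_prime hp
      (by rw [Nat.card_congr Multiplicative.toAdd, Nat.card_zmod]), Subgroup.mem_comap,
      Subgroup.mem_bot] at h2
    have h3 : ZMod.castHom (hdvd i) (ZMod p) (x.toAdd i) = 0 := h2
    have : NeZero (p ^ (f i + 1)) := ⟨pow_ne_zero _ hp.ne_zero⟩
    rwa [ZMod.castHom_apply, ZMod.cast_eq_val] at h3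
  choose c hc using fun i => (ZMod.natCast_eq_zero_iff _ _).1 (h1 i)
  refine ⟨Multiplicative.ofAdd fun i => (c i : ZMod (p ^ (f i + 1))), ?_⟩
  apply Multiplicative.toAdd.injective
  funext i
  have : NeZero (p ^ (f i + 1)) := ⟨pow_ne_zero _ hp.ne_zero⟩
  change p • (c i : ZMod (p ^ (f i + 1))) = x.toAdd i
  rw [nsmul_eq_mul, ← Nat.cast_mul, ← hc, ZMod.natCast_zmod_val]

theorem card_powMonoidHom_ker_multiplicative_pi_zmod {κ : Type*} [Fintype κ] {p : ℕ}
    (hp : p.Prime) (f : κ → ℕ) :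
    Nat.card (powMonoidHom p : Multiplicative (∀ i, ZMod (p ^ (f i + 1))) →* _).ker =
      p ^ Fintype.card κ := by
  have ε : (powMonoidHom p : Multiplicative (∀ i, ZMod (p ^ (f i + 1))) →* _).ker ≃
      ∀ i, (powMonoidHom p : Multiplicative (ZMod (p ^ (f i + 1))) →* _).ker :=
    { toFun := fun x i => ⟨Multiplicative.ofAdd (x.1.toAdd i),
        congrFun (congrArg Multiplicative.toAdd x.2) i⟩
      invFun := fun y => ⟨Multiplicative.ofAdd fun i => (y i).1.toAdd,
        congrArg Multiplicative.ofAdd (funext fun i => congrArg Multiplicative.toAdd (y i).2)⟩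
      left_inv := fun _ => rfl
      right_inv := fun _ => rfl }
  have hcard (i) : Nat.card (powMonoidHom p : Multiplicative (ZMod (p ^ (f i + 1))) →* _).ker =
      p := by
    have : NeZero (p ^ (f i + 1)) := ⟨pow_ne_zero _ hp.ne_zero⟩
    have : Finite (Multiplicative (ZMod (p ^ (f i + 1)))) :=
      inferInstanceAs (Finite (ZMod (p ^ (f i + 1))))
    rw [IsCyclic.card_powMonoidHom_ker, Nat.card_congr Multiplicative.toAdd, Nat.card_zmod]
    exact Nat.gcd_eq_right (dvd_pow_self p (Nat.succ_ne_zero _))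
  rw [Nat.card_congr ε, Nat.card_pi]
  simp only [hcard, Finset.prod_const, Finset.card_univ]

theorem card_frattini_multiplicative_pi_zmod {κ : Type*} [Fintype κ] [DecidableEq κ] {p : ℕ}
    (hp : p.Prime) (f : κ → ℕ) :
    Nat.card (frattini (Multiplicative (∀ i, ZMod (p ^ (f i + 1))))) = p ^ ∑ i, f i := by
  have h1 := Subgroup.card_mul_index
    (powMonoidHom p : Multiplicative (∀ i, ZMod (p ^ (f i + 1))) →* _).ker
  rw [card_powMonoidHom_ker_multiplicative_pi_zmod hp, Subgroup.index_ker,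
    ← frattini_multiplicative_pi_zmod hp, card_multiplicative_pi_zmod p fun i => f i + 1,
    Finset.sum_add_distrib, Finset.sum_const, Finset.card_univ, smul_eq_mul, mul_one, pow_add,
    mul_comm] at h1
  exact Nat.eq_of_mul_eq_mul_right (pow_pos hp.pos _) h1

theorem card_frattini_congr {G H : Type*} [Group G] [Group H] (e : G ≃* H) :
    Nat.card (frattini G) = Nat.card (frattini H) := by
  have h : (frattini G).map e.toMonoidHom = frattini H := by
    refine le_antisymm ?_ ?_
    · rw [Subgroup.map_le_iff_le_comap]
      exact frattini_le_comap_frattini_of_surjective e.surjective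
    · intro x hx
      exact ⟨e.symm x, frattini_le_comap_frattini_of_surjective (φ := e.symm.toMonoidHom)
        e.symm.surjective hx, e.apply_symm_apply x⟩
  rw [← h]
  exact Nat.card_congr (e.subgroupMap _).toEquiv

end Frattini

/-! ### Invariants of a finite abelian `p`-group -/

theorem nonempty_mulEquiv_multiplicative_pi_congr {G : Type*} [Group G] {d d' : ℕ}
    {f : Fin d → ℕ} {f' : Fin d' → ℕ} (h : d' = d) (hf : ∀ i, f' i = f (Fin.cast h i))
    (hG : Nonempty (G ≃* Multiplicative (∀ i, ZMod (f i)))) :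
    Nonempty (G ≃* Multiplicative (∀ i, ZMod (f' i))) := by
  subst h
  obtain rfl : f' = f := funext hf
  exact hG

theorem exists_antitone_invariants {G : Type*} [CommGroup G] {p n : ℕ} (hp : p.Prime)
    (hG : Nat.card G = p ^ n) :
    ∃ (d : ℕ) (b : Fin d → ℕ), Antitone b ∧
      Nonempty (G ≃* Multiplicative (∀ i, ZMod (p ^ (b i + 1)))) := by
  have : Finite G := Nat.finite_of_card_ne_zero (hG ▸ pow_ne_zero _ hp.ne_zero)
  obtain ⟨ι, _, k, hk, ⟨e⟩⟩ := CommGroup.equiv_prod_multiplicative_zmod_of_finite G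
  have hpow (i) : ∃ c, k i = p ^ (c + 1) := by
    have h1 : k i ∣ p ^ n := by
      rw [← hG, Nat.card_congr e.toEquiv, Nat.card_pi]
      refine dvd_trans (dvd_of_eq ?_) (Finset.dvd_prod_of_mem _ (Finset.mem_univ i))
      rw [Nat.card_congr Multiplicative.toAdd, Nat.card_zmod]
    obtain ⟨c, -, hc⟩ := (Nat.dvd_prime_pow hp).1 h1
    rcases c with _ | c
    · exact absurd (hk i) (by rw [hc, pow_zero]; exact lt_irrefl 1)
    · exact ⟨c, hc⟩
  choose c hc using hpow
  obtain rfl : k = fun i => p ^ (c i + 1) := funext hc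
  let ε : Fin (Fintype.card ι) ≃ ι := (Fintype.equivFin ι).symm
  -- Increasing order in the dual is non-increasing order of the exponents.
  let σ := Tuple.sort (OrderDual.toDual ∘ c ∘ ε)
  let τ := σ.trans ε
  refine ⟨_, c ∘ τ, fun i j hij => Tuple.monotone_sort (OrderDual.toDual ∘ c ∘ ε) hij,
    ⟨(e.trans (MulEquiv.piMultiplicative _).symm).trans (AddEquiv.toMultiplicative
      (RingEquiv.piCongrLeft' (fun i => ZMod (p ^ (c i + 1))) τ.symm).toAddEquiv)⟩⟩

/-- Entries of `B` are the exponents minus one: zeros stand for copies of `Z_p`, and `B.sum` is the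
logarithm of the order of the Frattini subgroup. -/
theorem exists_list_invariants {G : Type*} [CommGroup G] {p n : ℕ} (hp : p.Prime)
    (hG : Nat.card G = p ^ n) :
    ∃ B : List ℕ, B.Pairwise (fun x y => y ≤ x) ∧
      Nonempty (G ≃* Multiplicative (∀ i : Fin B.length, ZMod (p ^ (B.get i + 1)))) := by
  obtain ⟨d, b, hb, hbG⟩ := exists_antitone_invariants hp hG
  refine ⟨List.ofFn b, List.pairwise_ofFn.2 fun i j hij => hb hij.le,
    nonempty_mulEquiv_multiplicative_pi_congr (List.length_ofFn) (fun i => ?_) hbG⟩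
  rw [List.get_ofFn]

theorem hasInvariants_map {G : Type*} [Group G] {p : ℕ} {B : List ℕ}
    (hB : B.Pairwise (fun x y => y ≤ x))
    (hG : Nonempty (G ≃* Multiplicative (∀ i : Fin B.length, ZMod (p ^ (B.get i + 1))))) :
    HasInvariants p G (B.map fun b : ℕ => (b : ℤ) + 1) := by
  refine ⟨?_, ?_, nonempty_mulEquiv_multiplicative_pi_congr (List.length_map _) (fun i => ?_) hG⟩
  · rw [List.pairwise_map]
    exact hB.imp fun h => by omega
  · intro x hx
    obtain ⟨b, -, rfl⟩ := List.mem_map.1 hx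
    omega
  · simp only [List.get_eq_getElem, List.getElem_map, Fin.val_cast]
    congr 1

/-! ### Numerical consequences -/

/-- The weighted sum `c * x₀ + (c + 1) * x₁ + ⋯` of a list. -/
def weightedSum : ℕ → List ℕ → ℕ
  | _, [] => 0
  | c, x :: l => c * x + weightedSum (c + 1) l

theorem sum_get_eq_weightedSum (l : List ℕ) (c : ℕ) :
    ∑ j : Fin l.length, ((j : ℕ) + c) * l.get j = weightedSum c l := by
  induction l generalizing c with
  | nil => rfl
  | cons x l ih =>
    rw [weightedSum, ← ih]
    change ∑ j : Fin (l.length + 1), _ = _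
    rw [Fin.sum_univ_succ]
    simp [add_assoc, add_comm 1 c]

theorem weightedSum_replicate_zero (c N : ℕ) : weightedSum c (List.replicate N 0) = 0 := by
  induction N generalizing c with
  | zero => rfl
  | succ N ih => rw [List.replicate_succ, weightedSum, ih, mul_zero]

theorem eq_replicate_of_sum_eq_zero {l : List ℕ} (h : l.sum = 0) :
    l = List.replicate l.length 0 :=
  List.eq_replicate_of_mem fun _ hb => List.sum_eq_zero_iff.1 h _ hb

/-- A leading zero in a non-increasing list would make the whole sum zero; this and the next two
lemmas enumerate the partitions of 1, 2 and 3, padded with zeros. -/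
theorem exists_of_sum_eq_one {l : List ℕ} (hl : l.Pairwise (fun x y => y ≤ x)) (h : l.sum = 1) :
    ∃ N, l = 1 :: List.replicate N 0 := by
  rcases l with _ | ⟨x, l⟩
  · simp at h
  · rw [List.sum_cons] at h
    rcases (by omega : x = 0 ∧ l.sum = 1 ∨ x = 1 ∧ l.sum = 0) with ⟨rfl, hs⟩ | ⟨rfl, hs⟩
    · have := List.sum_eq_zero_iff.2 fun y hy => Nat.le_zero.1 (List.rel_of_pairwise_cons hl hy)
      omega
    · exact ⟨_, by rw [← eq_replicate_of_sum_eq_zero hs]⟩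

theorem exists_of_sum_eq_two {l : List ℕ} (hl : l.Pairwise (fun x y => y ≤ x)) (h : l.sum = 2) :
    ∃ N, l = 1 :: 1 :: List.replicate N 0 ∨ l = 2 :: List.replicate N 0 := by
  rcases l with _ | ⟨x, l⟩
  · simp at h
  · rw [List.sum_cons] at h
    rcases (by omega : x = 0 ∧ l.sum = 2 ∨ x = 1 ∧ l.sum = 1 ∨ x = 2 ∧ l.sum = 0) with
      ⟨rfl, hs⟩ | ⟨rfl, hs⟩ | ⟨rfl, hs⟩
    · have := List.sum_eq_zero_iff.2 fun y hy => Nat.le_zero.1 (List.rel_of_pairwise_cons hl hy)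
      omega
    · obtain ⟨N, rfl⟩ := exists_of_sum_eq_one hl.of_cons hs
      exact ⟨N, Or.inl rfl⟩
    · exact ⟨_, Or.inr (by rw [← eq_replicate_of_sum_eq_zero hs])⟩

theorem exists_of_sum_eq_three {l : List ℕ} (hl : l.Pairwise (fun x y => y ≤ x))
    (h : l.sum = 3) :
    ∃ N, l = 3 :: List.replicate N 0 ∨ l = 2 :: 1 :: List.replicate N 0 ∨
      l = 1 :: 1 :: 1 :: List.replicate N 0 := by
  rcases l with _ | ⟨x, l⟩
  · simp at h
  · rw [List.sum_cons] at h
    rcases (by omega : x = 0 ∧ l.sum = 3 ∨ x = 1 ∧ l.sum = 2 ∨ x = 2 ∧ l.sum = 1 ∨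
      x = 3 ∧ l.sum = 0) with ⟨rfl, hs⟩ | ⟨rfl, hs⟩ | ⟨rfl, hs⟩ | ⟨rfl, hs⟩
    · have := List.sum_eq_zero_iff.2 fun y hy => Nat.le_zero.1 (List.rel_of_pairwise_cons hl hy)
      omega
    · obtain ⟨N, rfl | rfl⟩ := exists_of_sum_eq_two hl.of_cons hs
      · exact ⟨N, Or.inr (Or.inr rfl)⟩
      · have := List.rel_of_pairwise_cons hl (List.mem_cons_self)
        omega
    · obtain ⟨N, rfl⟩ := exists_of_sum_eq_one hl.of_cons hs
      exact ⟨N, Or.inr (Or.inl rfl)⟩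
    · exact ⟨_, Or.inl (by rw [← eq_replicate_of_sum_eq_zero hs])⟩

section Invariants

variable {G : Type*} [CommGroup G] {p : ℕ} {B : List ℕ}

theorem pow_get_dvd (hB : B.Pairwise (fun x y => y ≤ x)) (i j : Fin B.length) (hij : i ≤ j) :
    p ^ (B.get j + 1) ∣ p ^ (B.get i + 1) := by
  refine pow_dvd_pow p (Nat.succ_le_succ ?_)
  rcases hij.eq_or_lt with rfl | h
  · exact le_rfl
  · exact List.pairwise_iff_get.1 hB i j h

theorem modulus_pow_get (hB : B.Pairwise (fun x y => y ≤ x)) :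
    modulus (fun i : Fin B.length => p ^ (B.get i + 1)) = fun q => p ^ (B.get q.snd + 1) :=
  funext (modulus_eq_of_dvd (pow_get_dvd hB))

theorem card_of_invariants
    (e : G ≃* Multiplicative (∀ i : Fin B.length, ZMod (p ^ (B.get i + 1)))) :
    Nat.card G = p ^ (B.sum + B.length) := by
  rw [Nat.card_congr e.toEquiv, card_multiplicative_pi_zmod p fun i => B.get i + 1,
    Finset.sum_add_distrib]
  simp

theorem card_frattini_of_invariants (hp : p.Prime)
    (e : G ≃* Multiplicative (∀ i : Fin B.length, ZMod (p ^ (B.get i + 1)))) :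
    Nat.card (frattini G) = p ^ B.sum := by
  rw [card_frattini_congr e, card_frattini_multiplicative_pi_zmod hp]
  simp

theorem card_schurMultiplier_of_invariants (hB : B.Pairwise (fun x y => y ≤ x))
    (e : G ≃* Multiplicative (∀ i : Fin B.length, ZMod (p ^ (B.get i + 1)))) :
    Nat.card (SchurMultiplier G) =
      p ^ (weightedSum 0 B + ∑ i ∈ Finset.range B.length, i) := by
  obtain ⟨ε⟩ := nonempty_schurMultiplier_mulEquiv _ e
  rw [Nat.card_congr ε.toEquiv, modulus_pow_get hB,
    card_multiplicative_pi_zmod p fun q : OrderedPair (Fin B.length) => B.get q.snd + 1,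
    OrderedPair.sum_snd fun j => B.get j + 1, ← sum_get_eq_weightedSum, Finset.sum_range,
    ← Finset.sum_add_distrib]
  simp [mul_add]

theorem exponent_of_invariants {x : ℕ} {l : List ℕ} (hB : (x :: l).Pairwise (fun x y => y ≤ x))
    (e : G ≃* Multiplicative (∀ i : Fin (x :: l).length, ZMod (p ^ ((x :: l).get i + 1)))) :
    Monoid.exponent G = p ^ (x + 1) := by
  rw [Monoid.exponent_eq_of_mulEquiv e]
  exact exponent_multiplicative_pi_zmod_of_dvd (0 : Fin (l.length + 1))
    fun j => pow_get_dvd hB _ _ (Fin.zero_le _)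

theorem exponent_schurMultiplier_of_length_le_one (hB : B.length ≤ 1)
    (e : G ≃* Multiplicative (∀ i : Fin B.length, ZMod (p ^ (B.get i + 1)))) :
    Monoid.exponent (SchurMultiplier G) = 1 := by
  have := Fin.subsingleton_iff_le_one.2 hB
  have := OrderedPair.isEmpty_of_subsingleton (Fin B.length)
  obtain ⟨ε⟩ := nonempty_schurMultiplier_mulEquiv _ e
  rw [Monoid.exponent_eq_of_mulEquiv ε, exponent_multiplicative_pi_zmod_of_isEmpty]

theorem exponent_schurMultiplier_of_invariants {x y : ℕ} {l : List ℕ}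
    (hB : (x :: y :: l).Pairwise (fun x y => y ≤ x))
    (e : G ≃* Multiplicative
      (∀ i : Fin (x :: y :: l).length, ZMod (p ^ ((x :: y :: l).get i + 1)))) :
    Monoid.exponent (SchurMultiplier G) = p ^ (y + 1) := by
  obtain ⟨ε⟩ := nonempty_schurMultiplier_mulEquiv _ e
  rw [Monoid.exponent_eq_of_mulEquiv ε, modulus_pow_get hB]
  let u : OrderedPair (Fin (l.length + 2)) := ⟨0, 1, Fin.zero_lt_one⟩
  refine exponent_multiplicative_pi_zmod_of_dvd (m := fun q : OrderedPair (Fin (l.length + 2)) =>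
    p ^ ((x :: y :: l).get q.snd + 1)) u fun q => pow_get_dvd hB _ _ ?_
  exact Fin.one_le_of_ne_zero (Fin.pos_iff_ne_zero.1 ((Fin.zero_le _).trans_lt q.lt))

/-- Two indices form at most one pair, so there is no pair of pairs. -/
theorem exponent_metabelianMultiplier_of_length_le_two (hB : B.length ≤ 2)
    (e : G ≃* Multiplicative (∀ i : Fin B.length, ZMod (p ^ (B.get i + 1)))) :
    Monoid.exponent (MetabelianMultiplier G) = 1 := by
  have : Subsingleton (OrderedPair (Fin B.length)) := by
    refine ⟨fun q r => OrderedPair.ext (Fin.ext ?_) (Fin.ext ?_)⟩ <;>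
    · have h1 : (q.fst : ℕ) < q.snd := q.lt
      have h2 : (r.fst : ℕ) < r.snd := r.lt
      omega
  have := OrderedPair.isEmpty_of_subsingleton (OrderedPair (Fin B.length))
  obtain ⟨ε⟩ := nonempty_metabelianMultiplier_mulEquiv _ e
  rw [Monoid.exponent_eq_of_mulEquiv ε, exponent_multiplicative_pi_zmod_of_isEmpty]

/-- Only the pair `(0, 1)` has second index below 2, so of two distinct pairs one contributes a
modulus dividing `p^(z+1)`. The pairs `(0, 1)` and `(0, 2)` attain this bound. -/
theorem exponent_metabelianMultiplier_of_invariants {x y z : ℕ} {l : List ℕ}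
    (hB : (x :: y :: z :: l).Pairwise (fun x y => y ≤ x))
    (e : G ≃* Multiplicative
      (∀ i : Fin (x :: y :: z :: l).length, ZMod (p ^ ((x :: y :: z :: l).get i + 1)))) :
    Monoid.exponent (MetabelianMultiplier G) = p ^ (z + 1) := by
  obtain ⟨ε⟩ := nonempty_metabelianMultiplier_mulEquiv _ e
  rw [Monoid.exponent_eq_of_mulEquiv ε, modulus_pow_get hB]
  let m : OrderedPair (Fin (l.length + 3)) → ℕ := fun q => p ^ ((x :: y :: z :: l).get q.snd + 1)
  let two : Fin (l.length + 3) := ⟨2, by omega⟩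
  have le_two {q : OrderedPair (Fin (l.length + 3))} (h : two ≤ q.snd) : m q ∣ p ^ (z + 1) :=
    pow_get_dvd hB two _ h
  let u : OrderedPair (Fin (l.length + 3)) := ⟨0, 1, Fin.zero_lt_one⟩
  let v : OrderedPair (Fin (l.length + 3)) := ⟨0, two, Nat.zero_lt_two⟩
  have huv : u < v := by
    change toLex (u.fst, u.snd) < toLex (v.fst, v.snd)
    exact Prod.Lex.toLex_lt_toLex.2 (Or.inr ⟨rfl, Nat.one_lt_two⟩)
  let w : OrderedPair (OrderedPair (Fin (l.length + 3))) := ⟨u, v, huv⟩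
  have hw : modulus m w = p ^ (z + 1) :=
    Nat.gcd_eq_right (pow_get_dvd hB 1 two (one_le_two (α := ℕ)))
  rw [← hw]
  refine exponent_multiplicative_pi_zmod_of_dvd (m := modulus m) w fun q => ?_
  rw [hw]
  by_cases h1 : two ≤ q.fst.snd
  · exact (modulus_dvd_fst m q).trans (le_two h1)
  by_cases h2 : two ≤ q.snd.snd
  · exact (modulus_dvd_snd m q).trans (le_two h2)
  refine absurd q.lt (Eq.not_lt (OrderedPair.ext (Fin.ext ?_) (Fin.ext ?_))) <;>
  · have h3 : (q.fst.fst : ℕ) < q.fst.snd := q.fst.lt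
    have h4 : (q.snd.fst : ℕ) < q.snd.snd := q.snd.lt
    have h5 : ¬ 2 ≤ (q.fst.snd : ℕ) := h1
    have h6 : ¬ 2 ≤ (q.snd.snd : ℕ) := h2
    omega

end Invariants

/-- With `d = n - a` and weighted sum `w`, doubling `n(n-1)/2 - t = w + d(d-1)/2` gives `2an =
a(a+1) + 2t + 2w`, the relation that defines `m`. -/
theorem weightedSum_eq {B : List ℕ} {n a t m : ℕ} (hn : n = B.sum + B.length) (ha : a = B.sum)
    (hM : ((weightedSum 0 B + ∑ i ∈ Finset.range B.length, i : ℕ) : ℤ) =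
      (n : ℤ) * ((n : ℤ) - 1) / 2 - (t : ℤ))
    (hm : 2 * a * n = a * (a + 1) + 2 * t + 2 * m) : m = weightedSum 0 B := by
  have h1 : 2 * ((n : ℤ) * ((n : ℤ) - 1) / 2) = (n : ℤ) * ((n : ℤ) - 1) :=
    Int.mul_ediv_cancel' (even_iff_two_dvd.1 (Int.even_mul_pred_self _))
  have h2 : ((∑ i ∈ Finset.range B.length, i : ℕ) : ℤ) * 2 =
      (B.length : ℤ) * ((B.length : ℤ) - 1) := by
    rcases h : B.length with _ | d
    · simp
    · have := Finset.sum_range_id_mul_two (d + 1)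
      rw [Nat.add_sub_cancel] at this
      push_cast
      rw [add_sub_cancel_right]
      rw [← Nat.cast_succ, ← Nat.cast_mul, ← this]
      push_cast
      rfl
  zify at hm hn ha ⊢
  rw [Nat.cast_add] at hM
  generalize (n : ℤ) * ((n : ℤ) - 1) / 2 = u at *
  generalize ((∑ i ∈ Finset.range B.length, i : ℕ) : ℤ) = v at *
  generalize (weightedSum 0 B : ℤ) = w at *
  have h3 : (B.length : ℤ) = n - a := by linarith
  rw [h3] at h2
  nlinarith

end AbelianPGroup

open AbelianPGroup in
theorem corollary2p5 {G : Type*} [CommGroup G] (p n a t m k s : ℕ) (r : ℤ)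
    (hp : p.Prime)
    (hG : Nat.card G = p ^ n)
    (hM : (Nat.card (AbelianPGroup.SchurMultiplier G) : ℚ) =
      (p : ℚ) ^ ((n : ℤ) * ((n : ℤ) - 1) / 2 - (t : ℤ)))
    (ha : Nat.card (frattini G) = p ^ a)
    (hm : 2 * a * n = a * (a + 1) + 2 * t + 2 * m)
    (hks : m = k + s)
    (hexp : (Monoid.exponent G : ℚ) = (p : ℚ) ^ ((a : ℤ) - (k : ℤ) + 1))
    (hr : (Monoid.exponent (AbelianPGroup.SchurMultiplier G) : ℚ) *
        (Monoid.exponent (AbelianPGroup.MetabelianMultiplier G) : ℚ) =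
      (p : ℚ) ^ ((k : ℤ) + r)) :
    (r = 2 → a + 3 ≤ n ∧
      AbelianPGroup.HasInvariants p G
        ([(a : ℤ) - k + 1, (k : ℤ) - s + 1, (s : ℤ) + 1] ++ List.replicate (n - a - 3) 1)) ∧
    (r = 1 → a + 3 ≤ n → a + 4 ≤ n ∧
      AbelianPGroup.HasInvariants p G
        ([(a : ℤ) - k + 1, (k : ℤ) - s + 2, (s : ℤ) - 1, 2] ++ List.replicate (n - a - 4) 1)) ∧
    (r = 0 → a + 3 ≤ n →
      (a + 5 ≤ n ∧
        AbelianPGroup.HasInvariants p G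
          ([(a : ℤ) - k + 1, (k : ℤ) - s + 4, (s : ℤ) - 4, 2, 2] ++
            List.replicate (n - a - 5) 1)) ∨
      (a + 4 ≤ n ∧
        AbelianPGroup.HasInvariants p G
          ([(a : ℤ) - k + 1, (k : ℤ) - s + 3, (s : ℤ) - 3, 3] ++
            List.replicate (n - a - 4) 1))) ∧
    (r = -1 →
      (a + 4 ≤ n ∧
        AbelianPGroup.HasInvariants p G
          ([(a : ℤ) - k + 1, (k : ℤ) - s + 4, (s : ℤ) - 5, 4] ++
            List.replicate (n - a - 4) 1)) ∨
      (a + 5 ≤ n ∧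
        AbelianPGroup.HasInvariants p G
          ([(a : ℤ) - k + 1, (k : ℤ) - s + 5, (s : ℤ) - 6, 3, 2] ++
            List.replicate (n - a - 5) 1)) ∨
      (a + 6 ≤ n ∧
        AbelianPGroup.HasInvariants p G
          ([(a : ℤ) - k + 1, (k : ℤ) - s + 7, (s : ℤ) - 8, 2, 2, 2] ++
            List.replicate (n - a - 6) 1))) := by
  have hp1 : (1 : ℚ) < p := by exact_mod_cast hp.one_lt
  have zpow_inj {i j : ℤ} (h : (p : ℚ) ^ i = (p : ℚ) ^ j) : i = j :=
    zpow_right_injective₀ (zero_lt_one.trans hp1) hp1.ne' h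
  obtain ⟨B, hB, ⟨e⟩⟩ := exists_list_invariants hp hG
  have hinv := hasInvariants_map hB ⟨e⟩
  have hn : n = B.sum + B.length :=
    Nat.pow_right_injective hp.two_le (hG.symm.trans (card_of_invariants e))
  have ha' : a = B.sum :=
    Nat.pow_right_injective hp.two_le (ha.symm.trans (card_frattini_of_invariants hp e))
  have hw : m = weightedSum 0 B := by
    refine weightedSum_eq hn ha' (zpow_inj ?_) hm
    rw [← hM, card_schurMultiplier_of_invariants hB e, zpow_natCast, Nat.cast_pow]
  rcases B with _ | ⟨x, _ | ⟨y, _ | ⟨z, T⟩⟩⟩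
  -- For trivial `G`, `a = m = 0`, while exponent 1 would force `k = a + 1`, contrary to `k ≤ m`.
  · have : Subsingleton G := (Nat.card_eq_one_iff_unique.1 (by
      rw [hG, hn]
      simp)).1
    rw [Monoid.exp_eq_one_of_subsingleton, Nat.cast_one] at hexp
    have h2 := zpow_inj ((zpow_zero _).trans hexp)
    simp only [weightedSum, List.sum_nil] at hw ha'
    omega
  all_goals
    rw [exponent_of_invariants hB e, Nat.cast_pow, ← zpow_natCast] at hexp
    have hk := zpow_inj hexp
    simp only [weightedSum, List.sum_nil, List.sum_cons, List.length_cons, List.length_nil]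
      at hw ha' hn
    push_cast at hk
  -- One factor: `k = 0` and so `r = 0`, but `n - a = 1` violates `a + 3 ≤ n`.
  · rw [exponent_schurMultiplier_of_length_le_one (by simp) e,
      exponent_metabelianMultiplier_of_length_le_two (by simp) e, Nat.cast_one, one_mul] at hr
    have hr' := zpow_inj ((zpow_zero _).trans hr)
    refine ⟨?_, ?_, ?_, ?_⟩ <;> omega
  -- Two factors: `k = y` and so `r = 1`, but `n - a = 2`.
  · rw [exponent_schurMultiplier_of_invariants hB e,
      exponent_metabelianMultiplier_of_length_le_two (by simp) e, Nat.cast_one, mul_one,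
      Nat.cast_pow, ← zpow_natCast] at hr
    have hr' := zpow_inj hr
    push_cast at hr'
    refine ⟨?_, ?_, ?_, ?_⟩ <;> omega
  rw [exponent_schurMultiplier_of_invariants hB e,
    exponent_metabelianMultiplier_of_invariants hB e, ← Nat.cast_mul, ← pow_add,
    Nat.cast_pow, ← zpow_natCast] at hr
  have hr' := zpow_inj hr
  push_cast at hr'
  have hT : T.Pairwise fun x y => y ≤ x := hB.of_cons.of_cons.of_cons
  -- Combine `k = y + z + T.sum` with `y + z + 2 = k + r`.
  have hsum : (T.sum : ℤ) = 2 - r := by omega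
  have hinv' {l : List ℤ} (h : l = (x :: y :: z :: T).map fun b : ℕ => (b : ℤ) + 1) :
      HasInvariants p G l := h ▸ hinv
  -- In each case `s = z + 2 T₀ + 3 T₁ + 4 T₂ + ⋯` yields `z`, and `k` then yields `y`; for example
  -- `T = 1, 1, 1, 0, …` gives `z = s - 9`.
  refine ⟨fun hr0 => ?_, fun hr0 _ => ?_, fun hr0 _ => ?_, fun hr0 => ?_⟩
  · obtain ⟨N, rfl⟩ : ∃ N, T = List.replicate N 0 :=
      ⟨_, eq_replicate_of_sum_eq_zero (by omega)⟩
    simp only [weightedSum_replicate_zero, List.sum_replicate, List.length_replicate, smul_zero]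
      at hw ha' hn
    refine ⟨by omega, hinv' ?_⟩
    rw [show n - a - 3 = N by omega]
    simp only [List.map_cons, List.map_replicate, List.cons_append, List.nil_append,
      List.cons.injEq, Nat.cast_zero, zero_add, and_true]
    omega
  · obtain ⟨N, rfl⟩ := exists_of_sum_eq_one hT (by omega)
    simp only [weightedSum, weightedSum_replicate_zero, List.sum_cons, List.sum_replicate,
      List.length_cons, List.length_replicate, smul_zero] at hw ha' hn
    refine ⟨by omega, hinv' ?_⟩
    rw [show n - a - 4 = N by omega]
    simp only [List.map_cons, List.map_replicate, List.cons_append, List.nil_append,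
      List.cons.injEq, Nat.cast_zero, zero_add, and_true]
    omega
  · obtain ⟨N, rfl | rfl⟩ := exists_of_sum_eq_two hT (by omega)
    all_goals
      simp only [weightedSum, weightedSum_replicate_zero, List.sum_cons, List.sum_replicate,
        List.length_cons, List.length_replicate, smul_zero] at hw ha' hn
    · left
      refine ⟨by omega, hinv' ?_⟩
      rw [show n - a - 5 = N by omega]
      simp only [List.map_cons, List.map_replicate, List.cons_append, List.nil_append,
        List.cons.injEq, Nat.cast_zero, zero_add, and_true]
      omega
    · right
      refine ⟨by omega, hinv' ?_⟩
      rw [show n - a - 4 = N by omega]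
      simp only [List.map_cons, List.map_replicate, List.cons_append, List.nil_append,
        List.cons.injEq, Nat.cast_zero, zero_add, and_true]
      omega
  · obtain ⟨N, rfl | rfl | rfl⟩ := exists_of_sum_eq_three hT (by omega)
    all_goals
      simp only [weightedSum, weightedSum_replicate_zero, List.sum_cons, List.sum_replicate,
        List.length_cons, List.length_replicate, smul_zero] at hw ha' hn
    · left
      refine ⟨by omega, hinv' ?_⟩
      rw [show n - a - 4 = N by omega]
      simp only [List.map_cons, List.map_replicate, List.cons_append, List.nil_append,
        List.cons.injEq, Nat.cast_zero, zero_add, and_true]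
      omega
    · right; left
      refine ⟨by omega, hinv' ?_⟩
      rw [show n - a - 5 = N by omega]
      simp only [List.map_cons, List.map_replicate, List.cons_append, List.nil_append,
        List.cons.injEq, Nat.cast_zero, zero_add, and_true]
      omega
    · right; right
      refine ⟨by omega, hinv' ?_⟩
      rw [show n - a - 6 = N by omega]
      simp only [List.map_cons, List.map_replicate, List.cons_append, List.nil_append,
        List.cons.injEq, Nat.cast_zero, zero_add, and_true]
      omega
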